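/- Let $\mu$ be Lebesgue measure on $[-1,1]$, let $\mathbf{A}=[\mathbf a_1\,\cdots\,\mathbf a_n]$ with $\mathbf a_i\in L_2([-1,1],d\mu)$ (a tall quasimatrix; $\mathbf{A}x=\sum_i x_i\mathbf a_i$ for $x\in\mathbb C^n$), let $\mathbf b\in L_2([-1,1],d\mu)$ and $\lambda>0$. Let $z_{\mathbf A}:[-1,1]\to\mathbb C^n$ and $z_{\mathbf b}:[-1,1]\to\mathbb C$ be coordinate representations of $\mathbf A$ and $\mathbf b$, that is, square integrable functions with $\mathbf Ax=\sum_i x_i\overline{z_{\mathbf A}(\cdot)_i}$ for all $x\in\mathbb C^n$ and $\mathbf b=\overline{z_{\mathbf b}(\cdot)}$ in $L_2([-1,1],d\mu)$. Let $E$ be the open region inside the (Bernstein) ellipse in $\mathbb C$ with foci $\pm1$ that passes through $i$. Assume that $z_{\mathbf A}$ and $z_{\mathbf b}$ extend to bounded analytic functions $\hat z_{\mathbf A}:E\to\mathbb C^n$ and $\hat z_{\mathbf b}:E\to\mathbb C$, and put $$M_{\mathbf A}=\sup_{\zeta\in E}\|\hat z_{\mathbf A}(\zeta)\|_\infty,\qquad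 M_{\mathbf b}=\sup_{\zeta\in E}|\hat z_{\mathbf b}(\zeta)|.$$ For $x\in\mathbb C^n$ and $\eta\in[-1,1]$ put $$f_x(\eta)=\bigl|z_{\mathbf A}(\eta)^*x-\overline{z_{\mathbf b}(\eta)}\bigr|^2+\tfrac{\lambda}{2}\|x\|_2^2,\qquad g_x(\eta)=\frac{f_x(\eta)}{\int_{-1}^1 f_x(t)\,dt+\lambda}.$$ Let $\varepsilon\in(0,1)$ and let $s$ be an integer with $$s\ \ge\ \frac{\ln\bigl(8(\lambda^{-1}(nM_{\mathbf A}^2+M_{\mathbf b}^2)+1)\bigr)-\ln\varepsilon-\ln\sqrt2}{2\ln(1+\sqrt2)}+1 .$$ Let $\eta_1,\dots,\eta_s\in[-1,1]$ be the nodes of the $s$-point Gauss–Legendre quadrature, i.e. the $s$ distinct roots of the Legendre polynomial of degree $s$, and let $w_1,\dots,w_s>0$ be such that $w_1^2,\dots,w_s^2$ are the Gauss–Legendre weights (these nodes and weights exist). Then for every $x\in\mathbb C^n$ $$\Bigl|\int_{-1}^1 g_x(\eta)\,d\eta-\sum_{j=1}^s w_j^2\,g_x(\eta_j)\Bigr|\le\varepsilon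 .$$ Consequently, if $\mathbf A_\eta\in\mathbb C^{s\times n}$ is the matrix with rows $w_jz_{\mathbf A}(\eta_j)^*$ and $\mathbf b_\eta\in\mathbb C^s$ is the vector with entries $w_j\overline{z_{\mathbf b}(\eta_j)}$, then for every $x\in\mathbb C^n$ $$(1-\varepsilon)\bigl(\|\mathbf Ax-\mathbf b\|_{L_2}^2+\lambda\|x\|_2^2+\lambda\bigr)\le\|\mathbf A_\eta x-\mathbf b_\eta\|_2^2+\lambda\|x\|_2^2+\lambda\le(1+\varepsilon)\bigl(\|\mathbf Ax-\mathbf b\|_{L_2}^2+\lambda\|x\|_2^2+\lambda\bigr).$$ -/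

import Mathlib

open MeasureTheory Set Polynomial

noncomputable section

namespace SILR

/-! ### Quasimatrices -/

/-- A tall quasimatrix with `n` columns over `H`: a map from the column index to `H`. -/
abbrev TallQuasimatrix (n : ℕ) (H : Type*) := Fin n → H

/-- The product `A x = ∑ j, x j • A j` of a tall quasimatrix and a vector of `ℂⁿ`. -/
def TallQuasimatrix.mulVec {n : ℕ} {H : Type*} [AddCommMonoid H] [Module ℂ H]
    (A : TallQuasimatrix n H) (x : EuclideanSpace ℂ (Fin n)) : H :=
  ∑ j, x j • A j

/-- The function `z : Ω → ℂⁿ` is a coordinate representation of the tall quasimatrix `A` over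
`L₂(Ω, μ)`: it is square integrable, and `A x = ∑ i, x i * conj (z · i)` in `L₂` for every `x`. -/
structure IsCoordRep {Ω : Type*} [MeasurableSpace Ω] (μ : Measure Ω) {n : ℕ}
    (A : TallQuasimatrix n (Lp ℂ 2 μ)) (z : Ω → EuclideanSpace ℂ (Fin n)) : Prop where
  integrable_norm_sq : Integrable (fun t => ‖z t‖ ^ 2) μ
  mulVec_eq : ∀ x : EuclideanSpace ℂ (Fin n),
    (A.mulVec x : Ω → ℂ) =ᵐ[μ] fun t => ∑ i, x i * star (z t i)

/-- Lebesgue measure on `[-1, 1]`, as a measure on `ℝ`. -/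
def lebesgueIcc : Measure ℝ := volume.restrict (Icc (-1 : ℝ) 1)

/-! ### Gauss–Legendre quadrature -/

/-- The Legendre polynomial of degree `s` on `[-1, 1]`, by the formula of Rodrigues
`P_s = (2 ^ s * s!)⁻¹ * (d / dX) ^ s (X ^ 2 - 1) ^ s`. -/
def legendreP (s : ℕ) : ℝ[X] :=
  C ((2 ^ s * (s.factorial : ℝ))⁻¹) * derivative^[s] ((X ^ 2 - 1) ^ s)

/-- `η 0, …, η (s - 1)` are the `s` nodes of the Gauss–Legendre quadrature on `[-1, 1]` (in any
order), and `w j` is the positive square root of the quadrature weight that belongs to `η j`: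
the nodes are distinct roots of the Legendre polynomial of degree `s`, and the weight of `η j` is
the integral of the Lagrange basis polynomial of that node. -/
structure IsGaussLegendre (s : ℕ) (η w : Fin s → ℝ) : Prop where
  injective : Function.Injective η
  mem_Icc : ∀ j, η j ∈ Icc (-1 : ℝ) 1
  isRoot : ∀ j, (legendreP s).IsRoot (η j)
  pos : ∀ j, 0 < w j
  sq_eq : ∀ j, w j ^ 2 = ∫ t in (-1 : ℝ)..1, (Lagrange.basis Finset.univ η j).eval t

/-! ### The Bernstein ellipse -/

/-- The open region of the complex plane inside the ellipse with foci `±1` that passes through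
the point `p`. -/
def ellipseInterior (p : ℂ) : Set ℂ :=
  {ζ | dist ζ 1 + dist ζ (-1) < dist p 1 + dist p (-1)}

/-! ### The regression problem and its discretization -/

variable {n : ℕ}

/-- `f_x(t) = |z_A(t)^* x - conj (z_b(t))|² + (lam / 2) ‖x‖²`. -/
def fInt (zA : ℝ → EuclideanSpace ℂ (Fin n)) (zb : ℝ → ℂ) (lam : ℝ)
    (x : EuclideanSpace ℂ (Fin n)) (t : ℝ) : ℝ :=
  ‖(∑ i, star (zA t i) * x i) - star (zb t)‖ ^ 2 + lam / 2 * ‖x‖ ^ 2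

/-- The normalized integrand `g_x(t) = f_x(t) / (∫ f_x + lam)`. -/
def gInt (zA : ℝ → EuclideanSpace ℂ (Fin n)) (zb : ℝ → ℂ) (lam : ℝ)
    (x : EuclideanSpace ℂ (Fin n)) (t : ℝ) : ℝ :=
  fInt zA zb lam x t / ((∫ u in (-1 : ℝ)..1, fInt zA zb lam x u) + lam)

/-- The row sampled matrix, whose row `j` is `w j * z_A(η j)^*`. -/
def sampledMatrix {s : ℕ} (zA : ℝ → EuclideanSpace ℂ (Fin n)) (η w : Fin s → ℝ) :
    Matrix (Fin s) (Fin n) ℂ :=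
  Matrix.of fun j i => (w j : ℂ) * star (zA (η j) i)

/-- The row sampled vector, whose entry `j` is `w j * conj (z_b(η j))`. -/
def sampledVector {s : ℕ} (zb : ℝ → ℂ) (η w : Fin s → ℝ) : Fin s → ℂ :=
  fun j => (w j : ℂ) * star (zb (η j))

/-- The regularized objective `‖A x - b‖² + lam ‖x‖²` of the semi-infinite problem. -/
def objective {H : Type*} [NormedAddCommGroup H] [Module ℂ H]
    (A : TallQuasimatrix n H) (b : H) (lam : ℝ) (x : EuclideanSpace ℂ (Fin n)) : ℝ :=
  ‖A.mulVec x - b‖ ^ 2 + lam * ‖x‖ ^ 2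

/-- The regularized objective `‖B x - c‖² + lam ‖x‖²` of a finite problem (Euclidean norms). -/
def finiteObjective {s : ℕ} (B : Matrix (Fin s) (Fin n) ℂ) (c : Fin s → ℂ) (lam : ℝ)
    (x : EuclideanSpace ℂ (Fin n)) : ℝ :=
  ‖WithLp.toLp 2 (B.mulVec x.ofLp - c)‖ ^ 2 + lam * ‖x‖ ^ 2

end SILR

end

/-- Repeated integration by parts: the boundary terms vanish when the derivatives of order `< k`
of `u` do at `±1`. -/
theorem integral_iterate_derivative_mul (u : ℝ[X]) (k : ℕ)
    (h1 : ∀ i < k, (derivative^[i] u).eval 1 = 0) (h2 : ∀ i < k, (derivative^[i] u).eval (-1) = 0)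
    (q : ℝ[X]) :
    ∫ t in (-1 : ℝ)..1, (derivative^[k] u).eval t * q.eval t =
      (-1) ^ k * ∫ t in (-1 : ℝ)..1, u.eval t * (derivative^[k] q).eval t := by
  induction k generalizing q with
  | zero => simp
  | succ k ih =>
    have key := intervalIntegral.integral_deriv_mul_eq_sub
      (a := (-1 : ℝ)) (b := 1) (u := fun t => (derivative^[k] u).eval t) (v := fun t => q.eval t)
      (fun t _ => (derivative^[k] u).hasDerivAt t) (fun t _ => q.hasDerivAt t)
      ((Polynomial.continuous _).intervalIntegrable _ _)
      ((Polynomial.continuous _).intervalIntegrable _ _)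
    rw [intervalIntegral.integral_add (Continuous.intervalIntegrable (by fun_prop) _ _)
      (Continuous.intervalIntegrable (by fun_prop) _ _)] at key
    have hk := ih (fun i hi => h1 i (by omega)) (fun i hi => h2 i (by omega)) (derivative q)
    rw [hk, h1 k (by omega), h2 k (by omega)] at key
    rw [Function.iterate_succ_apply' derivative k u, Function.iterate_succ_apply derivative k q,
      pow_succ]
    linarith

namespace SILR

theorem eval_iterate_derivative_X_sq_sub_one_pow {s k : ℕ} (hk : k < s) {t : ℝ}
    (ht : t ^ 2 = 1) : (derivative^[k] ((X ^ 2 - 1 : ℝ[X]) ^ s)).eval t = 0 := by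
  have h := eval_dvd (x := t) (pow_sub_dvd_iterate_derivative_pow (X ^ 2 - 1 : ℝ[X]) s k)
  simpa [ht, Nat.sub_ne_zero_of_lt hk] using h

theorem natDegree_X_sq_sub_one_pow (s : ℕ) : ((X ^ 2 - 1 : ℝ[X]) ^ s).natDegree = 2 * s := by
  rw [natDegree_pow, ← C_1, natDegree_X_pow_sub_C, mul_comm]

theorem natDegree_iterate_derivative_X_sq_sub_one_pow {s k : ℕ} (hk : k ≤ 2 * s) :
    (derivative^[k] ((X ^ 2 - 1 : ℝ[X]) ^ s)).natDegree = 2 * s - k := by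
  induction k with
  | zero => exact natDegree_X_sq_sub_one_pow s
  | succ k ih =>
    rw [Function.iterate_succ_apply', natDegree_derivative, ih (by omega)]
    omega

theorem iterate_derivative_X_sq_sub_one_pow_ne_zero {s k : ℕ} (hk : k ≤ s) :
    derivative^[k] ((X ^ 2 - 1 : ℝ[X]) ^ s) ≠ 0 := by
  rcases Nat.eq_zero_or_pos s with rfl | hs
  · obtain rfl : k = 0 := by omega
    simp
  · intro h
    have := natDegree_iterate_derivative_X_sq_sub_one_pow (s := s) (k := k) (by omega)
    rw [h, natDegree_zero] at this
    omega

theorem legendreP_scalar_ne_zero (s : ℕ) : ((2 ^ s * (s.factorial : ℝ))⁻¹) ≠ 0 := by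
  positivity

theorem legendreP_ne_zero (s : ℕ) : legendreP s ≠ 0 :=
  mul_ne_zero (C_ne_zero.mpr (legendreP_scalar_ne_zero s))
    (iterate_derivative_X_sq_sub_one_pow_ne_zero le_rfl)

theorem natDegree_legendreP (s : ℕ) : (legendreP s).natDegree = s := by
  rw [legendreP, natDegree_C_mul (legendreP_scalar_ne_zero s),
    natDegree_iterate_derivative_X_sq_sub_one_pow (by omega)]
  omega

theorem roots_legendreP (s : ℕ) :
    (legendreP s).roots = (derivative^[s] ((X ^ 2 - 1 : ℝ[X]) ^ s)).roots :=
  roots_C_mul _ (legendreP_scalar_ne_zero s)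

/-- The Legendre polynomial of degree `s` is orthogonal to the polynomials of degree `< s`. -/
theorem integral_legendreP_mul_eq_zero {s : ℕ} {q : ℝ[X]} (hq : q.degree < s) :
    ∫ t in (-1 : ℝ)..1, (legendreP s * q).eval t = 0 := by
  have h := integral_iterate_derivative_mul ((X ^ 2 - 1 : ℝ[X]) ^ s) s
    (fun i hi => eval_iterate_derivative_X_sq_sub_one_pow hi (by norm_num))
    (fun i hi => eval_iterate_derivative_X_sq_sub_one_pow hi (by norm_num)) q
  rw [iterate_derivative_eq_zero_of_degree_lt hq] at h
  simp only [eval_zero, mul_zero, intervalIntegral.integral_zero] at h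
  simp [legendreP, mul_assoc, h]

theorem card_roots_iterate_derivative {s k : ℕ} (hk : k < s) :
    k + 2 ≤ (derivative^[k] ((X ^ 2 - 1 : ℝ[X]) ^ s)).roots.toFinset.card := by
  have hroot : ∀ j < s, ({1, -1} : Finset ℝ) ⊆
      (derivative^[j] ((X ^ 2 - 1 : ℝ[X]) ^ s)).roots.toFinset := by
    intro j hj t ht
    rw [Multiset.mem_toFinset, mem_roots (iterate_derivative_X_sq_sub_one_pow_ne_zero hj.le)]
    refine eval_iterate_derivative_X_sq_sub_one_pow hj ?_
    rcases Finset.mem_insert.mp ht with rfl | ht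
    · norm_num
    · rw [Finset.mem_singleton.mp ht]; norm_num
  have hpair : ({1, -1} : Finset ℝ).card = 2 := Finset.card_pair (by norm_num)
  induction k with
  | zero => exact hpair.ge.trans (Finset.card_le_card (hroot 0 hk))
  | succ k ih =>
    set p := derivative^[k] ((X ^ 2 - 1 : ℝ[X]) ^ s) with hp
    have h := card_roots_toFinset_le_card_roots_derivative_sdiff_roots_succ p
    have hd : derivative^[k + 1] ((X ^ 2 - 1 : ℝ[X]) ^ s) = derivative p :=
      Function.iterate_succ_apply' _ _ _
    have h1 := hroot (k + 1) hk
    rw [hd] at h1 ⊢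
    have h2 : (p.derivative.roots.toFinset \ p.roots.toFinset).card + 2 ≤
        p.derivative.roots.toFinset.card := by
      rw [← hpair, ← Finset.card_union_of_disjoint]
      · exact Finset.card_le_card (Finset.union_subset Finset.sdiff_subset h1)
      · exact Finset.disjoint_of_subset_right (hroot k (by omega)) Finset.sdiff_disjoint
    have := ih (by omega)
    omega

theorem card_roots_legendreP (s : ℕ) : (legendreP s).roots.toFinset.card = s := by
  apply le_antisymm
  · exact (Multiset.toFinset_card_le _).trans ((card_roots' _).trans (natDegree_legendreP s).le)
  · rw [roots_legendreP]
    cases s with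
    | zero => simp
    | succ k =>
      have h := card_roots_toFinset_le_derivative (derivative^[k] ((X ^ 2 - 1 : ℝ[X]) ^ (k + 1)))
      rw [← Function.iterate_succ_apply' derivative, Nat.succ_eq_add_one] at h
      have := card_roots_iterate_derivative (Nat.lt_add_one k)
      omega

theorem rootSet_iterate_derivative_subset {s k : ℕ} (hk : k ≤ s) :
    ((derivative^[k] ((X ^ 2 - 1 : ℝ[X]) ^ s)).map (algebraMap ℝ ℂ)).rootSet ℂ ⊆
      segment ℝ (-1 : ℂ) 1 := by
  induction k with
  | zero =>
    intro z hz
    have h := (mem_rootSet.mp hz).2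
    simp only [Function.iterate_zero, id, Polynomial.map_pow, Polynomial.map_sub,
      Polynomial.map_X, Polynomial.map_one, coe_aeval_eq_eval, eval_pow, eval_sub, eval_X,
      eval_one] at h
    have h2 : z ^ 2 = 1 ^ 2 := by rw [one_pow, ← sub_eq_zero, eq_zero_of_pow_eq_zero h]
    rcases sq_eq_sq_iff_eq_or_eq_neg.mp h2 with rfl | rfl
    · exact right_mem_segment _ _ _
    · exact left_mem_segment _ _ _
  | succ k ih =>
    rw [Function.iterate_succ_apply', ← derivative_map]
    refine (rootSet_derivative_subset_convexHull_rootSet ?_).trans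
      (convexHull_min (ih (by omega)) (convex_segment _ _))
    rw [degree_map, ← natDegree_pos_iff_degree_pos,
      natDegree_iterate_derivative_X_sq_sub_one_pow (by omega)]
    omega

theorem mem_Icc_of_mem_roots_legendreP {s : ℕ} {t : ℝ} (ht : t ∈ (legendreP s).roots) :
    t ∈ Icc (-1 : ℝ) 1 := by
  rw [roots_legendreP, mem_roots'] at ht
  have hz : (t : ℂ) ∈ segment ℝ (-1 : ℂ) 1 := by
    apply rootSet_iterate_derivative_subset (le_refl s)
    refine mem_rootSet.mpr ⟨(Polynomial.map_ne_zero_iff (algebraMap ℝ ℂ).injective).mpr ht.1, ?_⟩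
    rw [coe_aeval_eq_eval, ← Complex.coe_algebraMap, eval_map_algebraMap, aeval_algebraMap_apply,
      coe_aeval_eq_eval, ht.2, map_zero]
  obtain ⟨a, b, ha, hb, hab, h⟩ := hz
  have h' := congrArg Complex.re h
  simp at h'
  constructor <;> linarith

section Quadrature

variable {s : ℕ} {η : Fin s → ℝ}

theorem integral_eval_eq_sum_of_degree_lt (hη : Function.Injective η) {q : ℝ[X]}
    (hq : q.degree < s) :
    ∫ t in (-1 : ℝ)..1, q.eval t =
      ∑ j, (∫ t in (-1 : ℝ)..1, (Lagrange.basis Finset.univ η j).eval t) * q.eval (η j) := by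
  have h := Lagrange.eq_interpolate (s := Finset.univ) hη.injOn (f := q) (by simpa using hq)
  conv_lhs => rw [h]
  simp only [Lagrange.interpolate_apply, eval_finsetSum, eval_mul, eval_C]
  rw [intervalIntegral.integral_finsetSum fun j _ =>
    Continuous.intervalIntegrable (by fun_prop) _ _]
  simp [mul_comm]

/-- The Gauss–Legendre quadrature is exact for polynomials of degree `< 2 * s`. -/
theorem integral_eval_eq_sum_of_natDegree_lt (hη : Function.Injective η)
    (hroot : ∀ j, (legendreP s).IsRoot (η j)) {q : ℝ[X]} (hq : q.natDegree < 2 * s) :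
    ∫ t in (-1 : ℝ)..1, q.eval t =
      ∑ j, (∫ t in (-1 : ℝ)..1, (Lagrange.basis Finset.univ η j).eval t) * q.eval (η j) := by
  have hP := legendreP_ne_zero s
  have hdeg : (legendreP s).degree = s := by
    rw [degree_eq_natDegree hP, natDegree_legendreP]
  have hdiv : (q / legendreP s).degree < s := by
    rcases lt_or_ge q.degree (legendreP s).degree with hlt | hle
    · rw [(Polynomial.div_eq_zero_iff hP).mpr hlt, degree_zero]
      exact WithBot.bot_lt_coe s
    · have hadd := degree_add_div hP hle
      have hq0 : q / legendreP s ≠ 0 := fun h0 => ((Polynomial.div_eq_zero_iff hP).mp h0).not_ge hle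
      rw [← natDegree_lt_iff_degree_lt hq0]
      rw [← degree_mul] at hadd
      have := natDegree_eq_of_degree_eq hadd
      rw [natDegree_mul hP hq0, natDegree_legendreP] at this
      omega
  have hmod : (q % legendreP s).degree < s := hdeg ▸ EuclideanDomain.mod_lt q hP
  have hsplit := EuclideanDomain.div_add_mod q (legendreP s)
  have heval : ∀ j, q.eval (η j) = (q % legendreP s).eval (η j) := by
    intro j
    conv_lhs => rw [← hsplit]
    rw [eval_add, eval_mul, (hroot j).eq_zero, zero_mul, zero_add]
  have hint : ∫ t in (-1 : ℝ)..1, q.eval t = ∫ t in (-1 : ℝ)..1, (q % legendreP s).eval t := by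
    conv_lhs => rw [← hsplit]
    simp only [eval_add (p := legendreP s * _)]
    rw [intervalIntegral.integral_add ((Polynomial.continuous _).intervalIntegrable _ _)
      ((Polynomial.continuous _).intervalIntegrable _ _), integral_legendreP_mul_eq_zero hdiv,
      zero_add]
  rw [hint, integral_eval_eq_sum_of_degree_lt hη hmod]
  simp [heval]

theorem integral_basis_pos (hη : Function.Injective η)
    (hmem : ∀ j, η j ∈ Icc (-1 : ℝ) 1) (hroot : ∀ j, (legendreP s).IsRoot (η j)) (j : Fin s) :
    0 < ∫ t in (-1 : ℝ)..1, (Lagrange.basis Finset.univ η j).eval t := by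
  set l := Lagrange.basis Finset.univ η j with hl
  have hdeg : l.natDegree = s - 1 := by
    rw [hl, Lagrange.natDegree_basis hη.injOn (Finset.mem_univ j)]
    simp
  have hs : 0 < s := j.pos
  have h := integral_eval_eq_sum_of_natDegree_lt hη hroot (q := l ^ 2)
    (by rw [natDegree_pow, hdeg]; omega)
  rw [Finset.sum_eq_single j (fun i _ hi => by
    rw [eval_pow, hl, Lagrange.eval_basis_of_ne hi.symm (Finset.mem_univ i)]; simp) (by simp),
    eval_pow, hl, Lagrange.eval_basis_self hη.injOn (Finset.mem_univ j), one_pow, mul_one,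
    ← hl] at h
  rw [← h]
  refine intervalIntegral.integral_pos (by norm_num) (l ^ 2).continuous.continuousOn
    (fun t _ => by rw [eval_pow]; positivity) ⟨η j, hmem j, ?_⟩
  rw [eval_pow, hl, Lagrange.eval_basis_self hη.injOn (Finset.mem_univ j)]
  norm_num

theorem exists_isGaussLegendre (s : ℕ) : ∃ η w : Fin s → ℝ, IsGaussLegendre s η w := by
  let e := (legendreP s).roots.toFinset.equivFinOfCardEq (card_roots_legendreP s)
  have hmem : ∀ j, (e.symm j : ℝ) ∈ (legendreP s).roots := fun j =>
    Multiset.mem_toFinset.mp (e.symm j).2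
  have hinj : Function.Injective fun j => (e.symm j : ℝ) :=
    Subtype.val_injective.comp e.symm.injective
  have hIcc : ∀ j, (e.symm j : ℝ) ∈ Icc (-1 : ℝ) 1 := fun j =>
    mem_Icc_of_mem_roots_legendreP (hmem j)
  have hroot : ∀ j, (legendreP s).IsRoot (e.symm j : ℝ) := fun j => isRoot_of_mem_roots (hmem j)
  refine ⟨fun j => e.symm j, fun j => √(∫ t in (-1 : ℝ)..1,
    (Lagrange.basis Finset.univ (fun j => (e.symm j : ℝ)) j).eval t), hinj,
    hIcc, hroot,
    fun j => Real.sqrt_pos.mpr (integral_basis_pos hinj hIcc hroot j),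
    fun j => Real.sq_sqrt (integral_basis_pos hinj hIcc hroot j).le⟩

theorem IsGaussLegendre.integral_eval_eq_sum {w : Fin s → ℝ} (h : IsGaussLegendre s η w)
    {q : ℝ[X]} (hq : q.natDegree < 2 * s) :
    ∫ t in (-1 : ℝ)..1, q.eval t = ∑ j, w j ^ 2 * q.eval (η j) := by
  rw [integral_eval_eq_sum_of_natDegree_lt h.injective h.isRoot hq]
  simp [h.sq_eq]

theorem IsGaussLegendre.sum_sq {w : Fin s → ℝ} (h : IsGaussLegendre s η w) (hs : 0 < s) :
    ∑ j, w j ^ 2 = 2 := by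
  have := h.integral_eval_eq_sum (q := 1) (by simpa using hs)
  norm_num at this
  exact this.symm

/-- The quadrature error is at most `4` times the distance to the polynomials of degree `< 2 * s`,
in the uniform norm. -/
theorem IsGaussLegendre.abs_integral_sub_sum_le {w : Fin s → ℝ} (h : IsGaussLegendre s η w)
    (hs : 0 < s) {g : ℝ → ℝ} (hg : IntervalIntegrable g volume (-1) 1) {q : ℝ[X]}
    (hq : q.natDegree < 2 * s) {δ : ℝ} (hδ : ∀ t ∈ Icc (-1 : ℝ) 1, |g t - q.eval t| ≤ δ) :
    |(∫ t in (-1 : ℝ)..1, g t) - ∑ j, w j ^ 2 * g (η j)| ≤ 4 * δ := by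
  have h1 : |∫ t in (-1 : ℝ)..1, (g t - q.eval t)| ≤ δ * |1 - (-1)| := by
    refine (Real.norm_eq_abs _).symm.trans_le
      (intervalIntegral.norm_integral_le_of_norm_le_const fun t ht => ?_)
    rw [uIoc_of_le (by norm_num)] at ht
    exact hδ t (Ioc_subset_Icc_self ht)
  have h2 : |∑ j, w j ^ 2 * (g (η j) - q.eval (η j))| ≤ 2 * δ := by
    rw [← h.sum_sq hs, Finset.sum_mul]
    refine (Finset.abs_sum_le_sum_abs _ _).trans (Finset.sum_le_sum fun j _ => ?_)
    rw [abs_mul, abs_of_nonneg (sq_nonneg (w j))]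
    exact mul_le_mul_of_nonneg_left (hδ _ (h.mem_Icc j)) (sq_nonneg _)
  rw [intervalIntegral.integral_sub hg ((Polynomial.continuous _).intervalIntegrable _ _),
    h.integral_eval_eq_sum hq] at h1
  simp only [mul_sub, Finset.sum_sub_distrib] at h2
  norm_num at h1
  rw [abs_le] at *
  constructor <;> linarith [h1.1, h1.2, h2.1, h2.2]

end Quadrature

end SILR

theorem circleIntegral_eq_of_differentiableAt_annulus {E : Type*} [NormedAddCommGroup E]
    [NormedSpace ℂ E] {a b : ℝ} (ha : 0 ≤ a) {G : ℂ → E}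
    (hG : ∀ z : ℂ, a < ‖z‖ → ‖z‖ < b → DifferentiableAt ℂ G z) {r R : ℝ}
    (hr : r ∈ Ioo a b) (hR : R ∈ Ioo a b) :
    (∮ z in C(0, R), G z) = ∮ z in C(0, r), G z := by
  wlog h : r ≤ R generalizing r R
  · exact (this hR hr (le_of_not_ge h)).symm
  refine Complex.circleIntegral_eq_of_differentiable_on_annulus_off_countable
    (ha.trans_lt hr.1) h countable_empty ?_ ?_
  · intro z hz
    simp only [mem_sdiff, Metric.mem_closedBall, Metric.mem_ball, dist_zero_right, not_lt] at hz
    exact (hG z (hr.1.trans_le hz.2) (hz.1.trans_lt hR.2)).continuousAt.continuousWithinAt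
  · intro z hz
    simp only [mem_sdiff, Metric.mem_closedBall, Metric.mem_ball, dist_zero_right, not_le] at hz
    exact hG z (hr.1.trans hz.1.2) (hz.1.1.trans hR.2)

/-- Cauchy estimates for the Laurent coefficients of a bounded analytic function on the annulus
`ρ⁻¹ < |z| < ρ`. -/
theorem norm_laurentCoeff_le {ρ M : ℝ} (hρ : 1 < ρ) {F : ℂ → ℂ}
    (hF : ∀ z : ℂ, ρ⁻¹ < ‖z‖ → ‖z‖ < ρ → DifferentiableAt ℂ F z)
    (hM : ∀ z : ℂ, ρ⁻¹ < ‖z‖ → ‖z‖ < ρ → ‖F z‖ ≤ M) (n : ℤ) :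
    ‖(2 * Real.pi * Complex.I : ℂ)⁻¹ • ∮ z in C(0, 1), z ^ (-n - 1) * F z‖ ≤
      M * ρ⁻¹ ^ n.natAbs := by
  have hρ0 : 0 < ρ := by positivity
  have hρi : ρ⁻¹ < 1 := inv_lt_one_of_one_lt₀ hρ
  have hR : ∀ R ∈ Ioo ρ⁻¹ ρ, ‖(2 * Real.pi * Complex.I : ℂ)⁻¹ •
      ∮ z in C(0, 1), z ^ (-n - 1) * F z‖ ≤ R ^ (-n) * M := by
    intro R hR
    have hR0 : 0 < R := (inv_pos.mpr hρ0).trans hR.1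
    rw [circleIntegral_eq_of_differentiableAt_annulus (G := fun z => z ^ (-n - 1) * F z)
      (inv_pos.mpr hρ0).le (fun z h1 h2 => (differentiableAt_zpow.mpr (Or.inl
        (norm_pos_iff.mp ((inv_pos.mpr hρ0).trans h1)))).mul (hF z h1 h2)) hR ⟨hρi, hρ⟩]
    refine (circleIntegral.norm_two_pi_i_inv_smul_integral_le_of_norm_le_const hR0.le
      (C := R ^ (-n - 1) * M) fun z hz => ?_).trans_eq ?_
    · rw [mem_sphere_zero_iff_norm] at hz
      rw [norm_mul, norm_zpow, hz]
      exact mul_le_mul_of_nonneg_left (hM z (hz ▸ hR.1) (hz ▸ hR.2)) (zpow_pos hR0 _).le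
    · rw [← mul_assoc, ← zpow_one_add₀ hR0.ne']
      congr 2
      ring
  have hlim : ∀ a : ℝ, 0 < a → ContinuousAt (fun R : ℝ => R ^ (-n) * M) a := fun a ha =>
    (continuousAt_zpow₀ a (-n) (Or.inl ha.ne')).mul continuousAt_const
  rcases le_total 0 n with hn | hn
  · have h := ge_of_tendsto ((hlim ρ hρ0).tendsto.mono_left (nhdsWithin_le_nhds (s := Iio ρ)))
      (Filter.mem_of_superset (Ioo_mem_nhdsLT (hρi.trans hρ)) hR)
    refine h.trans_eq ?_
    rw [mul_comm, inv_pow, zpow_neg, ← zpow_natCast, Int.natCast_natAbs, abs_of_nonneg hn]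
  · have h := ge_of_tendsto ((hlim ρ⁻¹ (inv_pos.mpr hρ0)).tendsto.mono_left
      (nhdsWithin_le_nhds (s := Ioi ρ⁻¹)))
      (Filter.mem_of_superset (Ioo_mem_nhdsGT (hρi.trans hρ)) hR)
    refine h.trans_eq ?_
    rw [mul_comm, ← zpow_natCast, Int.natCast_natAbs, abs_of_nonpos hn]

local instance : Fact (0 < 2 * Real.pi) := ⟨Real.two_pi_pos⟩

theorem AddCircle.toCircle_two_pi_coe (θ : ℝ) :
    ((AddCircle.toCircle (θ : AddCircle (2 * Real.pi)) : Circle) : ℂ) =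
      Complex.exp (θ * Complex.I) := by
  rw [AddCircle.toCircle_apply_mk, Circle.coe_exp, div_self Real.two_pi_pos.ne', one_mul]

theorem fourierCoeff_comp_toCircle (F : ℂ → ℂ) (n : ℤ) :
    fourierCoeff (fun x : AddCircle (2 * Real.pi) => F (AddCircle.toCircle x)) n =
      (2 * Real.pi * Complex.I : ℂ)⁻¹ • ∮ z in C(0, 1), z ^ (-n - 1) * F z := by
  have key : (∮ z in C(0, 1), z ^ (-n - 1) * F z) =
      Complex.I * ∫ θ in (0 : ℝ)..2 * Real.pi,
        Complex.exp (θ * Complex.I) ^ (-n) * F (Complex.exp (θ * Complex.I)) := by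
    rw [circleIntegral, ← intervalIntegral.integral_const_mul]
    refine intervalIntegral.integral_congr fun θ _ => ?_
    have hne := Complex.exp_ne_zero (θ * Complex.I)
    simp only [deriv_circleMap, circleMap, Complex.ofReal_one, one_mul, zero_add, smul_eq_mul]
    rw [zpow_sub_one₀ hne]
    field_simp
  rw [fourierCoeff_eq_intervalIntegral _ _ 0, key, zero_add]
  have hint : ∀ θ : ℝ, fourier (-n) (θ : AddCircle (2 * Real.pi)) •
      F (AddCircle.toCircle (θ : AddCircle (2 * Real.pi))) =
        Complex.exp (θ * Complex.I) ^ (-n) * F (Complex.exp (θ * Complex.I)) := by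
    intro θ
    rw [fourier_apply, AddCircle.toCircle_zsmul, Circle.coe_zpow, AddCircle.toCircle_two_pi_coe,
      smul_eq_mul]
  simp only [hint]
  rw [Complex.real_smul, smul_eq_mul, ← mul_assoc]
  congr 1
  push_cast
  have := Complex.I_ne_zero
  field_simp

/-- The Laurent series of a bounded analytic function on `ρ⁻¹ < |z| < ρ`, on the unit circle. -/
theorem exists_hasSum_exp_of_annulus {ρ M : ℝ} (hρ : 1 < ρ) {F : ℂ → ℂ}
    (hF : ∀ z : ℂ, ρ⁻¹ < ‖z‖ → ‖z‖ < ρ → DifferentiableAt ℂ F z)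
    (hM : ∀ z : ℂ, ρ⁻¹ < ‖z‖ → ‖z‖ < ρ → ‖F z‖ ≤ M) :
    ∃ a : ℤ → ℂ, (∀ n, ‖a n‖ ≤ M * ρ⁻¹ ^ n.natAbs) ∧
      ∀ θ : ℝ, HasSum (fun n : ℤ => a n * Complex.exp (n * θ * Complex.I))
        (F (Complex.exp (θ * Complex.I))) := by
  have hρ0 : 0 < ρ := by positivity
  have hρi : ρ⁻¹ < 1 := inv_lt_one_of_one_lt₀ hρ
  let f : C(AddCircle (2 * Real.pi), ℂ) :=
    ⟨fun x => F (AddCircle.toCircle x), continuous_iff_continuousAt.mpr fun x =>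
      ContinuousAt.comp (g := F)
        (hF _ (by rwa [Circle.norm_coe]) (by rwa [Circle.norm_coe])).continuousAt
        (continuous_subtype_val.comp AddCircle.continuous_toCircle).continuousAt⟩
  have hbound : ∀ n, ‖fourierCoeff f n‖ ≤ M * ρ⁻¹ ^ n.natAbs := fun n => by
    rw [show fourierCoeff f n = _ from fourierCoeff_comp_toCircle F n]
    exact norm_laurentCoeff_le hρ hF hM n
  have hgeom : Summable fun n : ℤ => M * ρ⁻¹ ^ n.natAbs := by
    rw [summable_int_iff_summable_nat_and_neg]
    simpa using ((summable_geometric_of_lt_one (inv_pos.mpr hρ0).le hρi).mul_left M)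
  refine ⟨fourierCoeff f, hbound, fun θ => ?_⟩
  have h := has_pointwise_sum_fourier_series_of_summable
    (hgeom.of_norm_bounded hbound) (θ : AddCircle (2 * Real.pi))
  have hv : f (θ : AddCircle (2 * Real.pi)) = F (Complex.exp (θ * Complex.I)) :=
    congrArg F (AddCircle.toCircle_two_pi_coe θ)
  rw [hv] at h
  simpa only [smul_eq_mul, fourier_apply, AddCircle.toCircle_zsmul, Circle.coe_zpow,
    AddCircle.toCircle_two_pi_coe, ← Complex.exp_int_mul, mul_assoc] using h

namespace SILR

theorem dist_joukowski_add_dist {z : ℂ} (hz : z ≠ 0) :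
    dist ((z + z⁻¹) / 2) 1 + dist ((z + z⁻¹) / 2) (-1) = ‖z‖ + ‖z‖⁻¹ := by
  have hz' : 0 < ‖z‖ := norm_pos_iff.mpr hz
  have h1 : (z + z⁻¹) / 2 - 1 = (z - 1) ^ 2 / (2 * z) := by field_simp; ring
  have h2 : (z + z⁻¹) / 2 - -1 = (z + 1) ^ 2 / (2 * z) := by field_simp; ring
  have h3 := parallelogram_law_with_norm ℝ z 1
  rw [norm_one] at h3
  rw [dist_eq_norm, dist_eq_norm, h1, h2, norm_div, norm_div, norm_pow, norm_pow, norm_mul,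
    RCLike.norm_ofNat]
  field_simp
  linarith

/-- The region inside the ellipse with foci `±1` and sum of the semi-axes `ρ`. -/
def bernsteinEllipse (ρ : ℝ) : Set ℂ := {ζ | dist ζ 1 + dist ζ (-1) < ρ + ρ⁻¹}

theorem joukowski_mem_bernsteinEllipse {ρ : ℝ} {z : ℂ} (h0 : 0 < ρ) (h1 : ρ⁻¹ < ‖z‖)
    (h2 : ‖z‖ < ρ) : (z + z⁻¹) / 2 ∈ bernsteinEllipse ρ := by
  have hz : 0 < ‖z‖ := (inv_pos.mpr h0).trans h1
  rw [bernsteinEllipse, mem_ofPred_eq, dist_joukowski_add_dist (norm_pos_iff.mp hz)]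
  have h3 : 1 < ρ * ‖z‖ := by rwa [inv_lt_iff_one_lt_mul₀' h0] at h1
  have h4 : ρ + ρ⁻¹ - (‖z‖ + ‖z‖⁻¹) = (ρ - ‖z‖) * (ρ * ‖z‖ - 1) / (ρ * ‖z‖) := by
    field_simp; ring
  have : 0 < (ρ - ‖z‖) * (ρ * ‖z‖ - 1) / (ρ * ‖z‖) := by
    have := sub_pos.mpr h2
    have := sub_pos.mpr h3
    positivity
  linarith

theorem isOpen_bernsteinEllipse (ρ : ℝ) : IsOpen (bernsteinEllipse ρ) :=
  isOpen_lt (by fun_prop) continuous_const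

/-- The Chebyshev expansion of a bounded analytic function in a Bernstein ellipse. -/
theorem exists_hasSum_chebyshev {ρ M : ℝ} (hρ : 1 < ρ) {f : ℂ → ℂ}
    (hf : DifferentiableOn ℂ f (bernsteinEllipse ρ))
    (hM : ∀ ζ ∈ bernsteinEllipse ρ, ‖f ζ‖ ≤ M) :
    ∃ c : ℕ → ℂ, (∀ n, ‖c n‖ ≤ 2 * M * ρ⁻¹ ^ n) ∧ ∀ t ∈ Icc (-1 : ℝ) 1,
      HasSum (fun n : ℕ => c n * ((Chebyshev.T ℝ n).eval t : ℝ)) (f t) := by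
  have hρ0 : 0 < ρ := by positivity
  have hmem := fun (z : ℂ) (h1 : ρ⁻¹ < ‖z‖) (h2 : ‖z‖ < ρ) =>
    joukowski_mem_bernsteinEllipse hρ0 h1 h2
  obtain ⟨a, ha, hsum⟩ := exists_hasSum_exp_of_annulus (M := M) hρ
    (F := fun z => f ((z + z⁻¹) / 2))
    (fun z h1 h2 => DifferentiableAt.comp (g := f) z
      (hf.differentiableAt ((isOpen_bernsteinEllipse ρ).mem_nhds (hmem z h1 h2)))
      ((differentiableAt_id.add (differentiableAt_inv
        (norm_pos_iff.mp ((inv_pos.mpr hρ0).trans h1)))).div_const 2))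
    (fun z h1 h2 => hM _ (hmem z h1 h2))
  have hM0 : 0 ≤ M := by simpa using (norm_nonneg _).trans (ha 0)
  refine ⟨fun n => a n + if n = 0 then 0 else a (-n), fun n => ?_, fun t ht => ?_⟩
  · have h1 := ha n
    have h2 := ha (-n)
    rw [Int.natAbs_neg] at h2
    rw [Int.natAbs_natCast] at h1 h2
    refine (norm_add_le _ _).trans ?_
    split_ifs
    · rw [norm_zero]
      have : 0 ≤ M * ρ⁻¹ ^ n := by positivity
      linarith
    · linarith
  · set θ := Real.arccos t with hθ
    have hcos : Real.cos θ = t := Real.cos_arccos ht.1 ht.2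
    have hval : ∀ φ : ℝ, (Complex.exp (φ * Complex.I) + (Complex.exp (φ * Complex.I))⁻¹) / 2 =
        (Real.cos φ : ℝ) := fun φ => by
      rw [← Complex.exp_neg, Complex.ofReal_cos, Complex.cos, neg_mul]
    have h1 := hsum θ
    have h2 := hsum (-θ)
    simp only [hval, Real.cos_neg, hcos] at h1 h2
    have h3 : HasSum (fun n : ℤ => a n * ((Chebyshev.T ℝ n).eval t : ℝ)) (f t) := by
      have h := (h1.add h2).div_const 2
      rw [add_self_div_two] at h
      refine h.congr_fun fun n => ?_
      rw [← hcos, Chebyshev.T_real_cos, Complex.ofReal_cos, Complex.cos]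
      push_cast
      ring_nf
    have h4 := h3.nat_add_neg.sub (hasSum_ite_eq (0 : ℕ) (a 0 * ((Chebyshev.T ℝ 0).eval t : ℝ)))
    rw [add_sub_cancel_right] at h4
    refine h4.congr_fun fun n => ?_
    rw [Chebyshev.T_neg]
    by_cases hn : n = 0
    · subst hn; simp
    · simp only [hn, if_false]
      ring

/-- Polynomial approximation of a function that is real on `[-1, 1]` and analytic and bounded in a
Bernstein ellipse. -/
theorem exists_polynomial_approx {ρ M : ℝ} (hρ : 1 < ρ) {f : ℂ → ℂ}
    (hf : DifferentiableOn ℂ f (bernsteinEllipse ρ))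
    (hM : ∀ ζ ∈ bernsteinEllipse ρ, ‖f ζ‖ ≤ M) {m : ℕ} (hm : 0 < m) :
    ∃ q : ℝ[X], q.natDegree < m ∧
      ∀ t ∈ Icc (-1 : ℝ) 1, |(f t).re - q.eval t| ≤ 2 * M * ρ⁻¹ ^ m / (1 - ρ⁻¹) := by
  obtain ⟨c, hc, hsum⟩ := exists_hasSum_chebyshev hρ hf hM
  refine ⟨∑ n ∈ Finset.range m, C (c n).re * Chebyshev.T ℝ n, ?_, fun t ht => ?_⟩
  · refine (natDegree_sum_le_of_forall_le (n := m - 1) _ _ fun n hn => ?_).trans_lt (by omega)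
    refine (natDegree_C_mul_le _ _).trans ?_
    rw [Chebyshev.natDegree_T, Int.natAbs_natCast]
    exact Nat.le_sub_one_of_lt (Finset.mem_range.mp hn)
  · have hre : HasSum (fun n : ℕ => (c n).re * (Chebyshev.T ℝ n).eval t) (f t).re := by
      simpa only [Complex.re_mul_ofReal] using Complex.hasSum_re (hsum t ht)
    have h := norm_sub_le_of_geometric_bound_of_hasSum (C := 2 * M) (inv_lt_one_of_one_lt₀ hρ)
      (fun n => ?_) hre m
    · rw [abs_sub_comm, eval_finsetSum]
      simpa using h
    · rw [norm_mul]
      refine (mul_le_of_le_one_right (norm_nonneg _) ?_).trans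
        ((Complex.abs_re_le_norm _).trans (hc n))
      exact Chebyshev.abs_eval_T_real_le_one n (abs_le.mpr ht)

end SILR

namespace SILR

theorem ellipseInterior_I : ellipseInterior Complex.I = bernsteinEllipse (1 + √2) := by
  have hsq : √2 ^ 2 = (2 : ℝ) := Real.sq_sqrt (by norm_num)
  have h1 : dist Complex.I 1 = √2 := by
    rw [dist_eq_norm, Complex.norm_eq_sqrt_sq_add_sq]; norm_num
  have h2 : dist Complex.I (-1) = √2 := by
    rw [dist_eq_norm, Complex.norm_eq_sqrt_sq_add_sq]; norm_num
  have h3 : (1 + √2)⁻¹ = √2 - 1 := by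
    rw [inv_eq_iff_eq_inv, eq_comm, inv_eq_of_mul_eq_one_left]
    linarith
  rw [ellipseInterior, bernsteinEllipse, h1, h2, h3]
  ring_nf

theorem ofReal_mem_bernsteinEllipse {ρ : ℝ} (hρ : 1 < ρ) {t : ℝ} (ht : t ∈ Icc (-1 : ℝ) 1) :
    (t : ℂ) ∈ bernsteinEllipse ρ := by
  have h1 : dist (t : ℂ) 1 = 1 - t := by
    rw [← Complex.ofReal_one, Complex.dist_of_im_eq (by simp), Complex.ofReal_re,
      Complex.ofReal_re, Real.dist_eq, abs_sub_comm, abs_of_nonneg (sub_nonneg.mpr ht.2)]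
  have h2 : dist (t : ℂ) (-1) = t + 1 := by
    rw [← Complex.ofReal_one, ← Complex.ofReal_neg, Complex.dist_of_im_eq (by simp),
      Complex.ofReal_re, Complex.ofReal_re, Real.dist_eq, sub_neg_eq_add,
      abs_of_nonneg (by linarith [ht.1])]
  rw [bernsteinEllipse, mem_ofPred_eq, h1, h2]
  have h3 : ρ + ρ⁻¹ - 2 = (ρ - 1) ^ 2 / ρ := by field_simp; ring
  have : 0 < (ρ - 1) ^ 2 / ρ := by
    have := sub_pos.mpr hρ
    positivity
  linarith

theorem star_mem_bernsteinEllipse {ρ : ℝ} {ζ : ℂ} (hζ : ζ ∈ bernsteinEllipse ρ) :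
    star ζ ∈ bernsteinEllipse ρ := by
  have h1 : dist (star ζ) 1 = dist ζ 1 := by
    rw [dist_eq_norm, dist_eq_norm, ← norm_star, star_sub, star_star, star_one]
  have h2 : dist (star ζ) (-1) = dist ζ (-1) := by
    rw [dist_eq_norm, dist_eq_norm, ← norm_star, star_sub, star_star, star_neg, star_one]
  rwa [bernsteinEllipse, mem_ofPred_eq, h1, h2]

/-- The Schwarz reflection of a function that is analytic in a Bernstein ellipse. -/
theorem differentiableOn_star_comp_star {ρ : ℝ} {f : ℂ → ℂ}
    (hf : DifferentiableOn ℂ f (bernsteinEllipse ρ)) :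
    DifferentiableOn ℂ (fun ζ => star (f (star ζ))) (bernsteinEllipse ρ) := by
  intro ζ hζ
  have h := ((hf.differentiableAt ((isOpen_bernsteinEllipse ρ).mem_nhds
    (star_mem_bernsteinEllipse hζ))).star_star)
  rw [star_star] at h
  exact h.differentiableWithinAt

/-- The Gauss–Legendre quadrature error of a function that is analytic and bounded in a Bernstein
ellipse. -/
theorem IsGaussLegendre.abs_integral_sub_sum_le_of_bernsteinEllipse {s : ℕ} {η w : Fin s → ℝ}
    (h : IsGaussLegendre s η w) (hs : 0 < s) {ρ M : ℝ} (hρ : 1 < ρ) {f : ℂ → ℂ}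
    (hf : DifferentiableOn ℂ f (bernsteinEllipse ρ))
    (hM : ∀ ζ ∈ bernsteinEllipse ρ, ‖f ζ‖ ≤ M) {g : ℝ → ℝ}
    (hg : ∀ t ∈ Icc (-1 : ℝ) 1, f t = g t) :
    |(∫ t in (-1 : ℝ)..1, g t) - ∑ j, w j ^ 2 * g (η j)| ≤
      8 * M * ρ⁻¹ ^ (2 * s) / (1 - ρ⁻¹) := by
  obtain ⟨q, hq, happ⟩ := exists_polynomial_approx hρ hf hM (m := 2 * s) (by omega)
  have hcont : ContinuousOn g (Icc (-1) 1) := by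
    have h1 : ContinuousOn (fun t : ℝ => (f t).re) (Icc (-1) 1) :=
      Complex.continuous_re.comp_continuousOn (hf.continuousOn.comp
        Complex.continuous_ofReal.continuousOn fun t ht => ofReal_mem_bernsteinEllipse hρ ht)
    exact h1.congr fun t ht => by simp [hg t ht]
  have hint : IntervalIntegrable g volume (-1) 1 :=
    ContinuousOn.intervalIntegrable (by rwa [uIcc_of_le (by norm_num)])
  refine (h.abs_integral_sub_sum_le hs hint hq
    fun t ht => by simpa [hg t ht] using happ t ht).trans_eq ?_
  ring

variable {n : ℕ}

theorem norm_sum_mul_sub_sq_le {a b : ℝ} {u : Fin n → ℂ} {v : ℂ}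
    (hu : ∀ i, ‖u i‖ ≤ a) (hv : ‖v‖ ≤ b) (x : EuclideanSpace ℂ (Fin n)) :
    ‖(∑ i, u i * x i) - v‖ ^ 2 ≤ (n * a ^ 2 + b ^ 2) * (‖x‖ ^ 2 + 1) := by
  set S := ∑ i, ‖x i‖ with hS
  have hSx : S ^ 2 ≤ n * ‖x‖ ^ 2 := by
    rw [EuclideanSpace.norm_sq_eq]
    simpa using sq_sum_le_card_mul_sum_sq (s := Finset.univ) (f := fun i => ‖x i‖)
  have h1 : ‖(∑ i, u i * x i) - v‖ ≤ a * S + b := by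
    refine (norm_sub_le _ _).trans (add_le_add ((norm_sum_le _ _).trans ?_) hv)
    rw [hS, Finset.mul_sum]
    refine Finset.sum_le_sum fun i _ => ?_
    rw [norm_mul]
    exact mul_le_mul_of_nonneg_right (hu i) (norm_nonneg _)
  refine (pow_le_pow_left₀ (norm_nonneg _) h1 2).trans ?_
  have h2 : a ^ 2 * S ^ 2 ≤ a ^ 2 * (n * ‖x‖ ^ 2) := mul_le_mul_of_nonneg_left hSx (sq_nonneg a)
  have h3 : 2 * a * b * S ≤ n * a ^ 2 + b ^ 2 * ‖x‖ ^ 2 := by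
    rcases Nat.eq_zero_or_pos n with rfl | hn
    · have : S = 0 := by simp [hS]
      rw [this, mul_zero]
      positivity
    · have hn' : (0 : ℝ) < n := Nat.cast_pos.mpr hn
      refine le_of_mul_le_mul_left ?_ hn'
      have := mul_le_mul_of_nonneg_left hSx (sq_nonneg b)
      nlinarith [sq_nonneg (n * a - b * S)]
  linarith

/-- The analytic continuation of `fInt`. -/
noncomputable def fHat (zAhat : ℂ → Fin n → ℂ) (zbhat : ℂ → ℂ) (lam : ℝ) (x : EuclideanSpace ℂ (Fin n))
    (ζ : ℂ) : ℂ :=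
  ((∑ i, star (zAhat (star ζ) i) * x i) - star (zbhat (star ζ))) *
    ((∑ i, zAhat ζ i * star (x i)) - zbhat ζ) + (lam / 2 * ‖x‖ ^ 2 : ℝ)

theorem fHat_ofReal {zA : ℝ → EuclideanSpace ℂ (Fin n)} {zb : ℝ → ℂ} {zAhat : ℂ → Fin n → ℂ}
    {zbhat : ℂ → ℂ} {t : ℝ} (hA : ∀ i, zAhat (t : ℂ) i = zA t i) (hb : zbhat (t : ℂ) = zb t)
    (lam : ℝ) (x : EuclideanSpace ℂ (Fin n)) :
    fHat zAhat zbhat lam x t = fInt zA zb lam x t := by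
  have ht : star (t : ℂ) = t := Complex.conj_ofReal t
  have hstar : (∑ i, zA t i * star (x i)) - zb t =
      star ((∑ i, star (zA t i) * x i) - star (zb t)) := by
    simp [star_sum, mul_comm]
  simp only [fHat, fInt, ht, hA, hb]
  rw [hstar, Complex.ofReal_add, Complex.ofReal_pow]
  congr 1
  exact Complex.mul_conj' _

theorem differentiableOn_fHat {ρ : ℝ} {zAhat : ℂ → Fin n → ℂ} {zbhat : ℂ → ℂ}
    (hzA : DifferentiableOn ℂ zAhat (bernsteinEllipse ρ))
    (hzb : DifferentiableOn ℂ zbhat (bernsteinEllipse ρ)) (lam : ℝ)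
    (x : EuclideanSpace ℂ (Fin n)) :
    DifferentiableOn ℂ (fHat zAhat zbhat lam x) (bernsteinEllipse ρ) := by
  have hi := differentiableOn_pi.mp hzA
  refine DifferentiableOn.add_const _ (DifferentiableOn.mul (DifferentiableOn.sub
    (DifferentiableOn.fun_sum fun i _ => (differentiableOn_star_comp_star (hi i)).mul_const _)
    (differentiableOn_star_comp_star hzb)) (DifferentiableOn.sub
    (DifferentiableOn.fun_sum fun i _ => (hi i).mul_const _) hzb))

theorem norm_fHat_le {ρ a b lam : ℝ} {zAhat : ℂ → Fin n → ℂ} {zbhat : ℂ → ℂ}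
    (hA : ∀ ζ ∈ bernsteinEllipse ρ, ‖zAhat ζ‖ ≤ a) (hb : ∀ ζ ∈ bernsteinEllipse ρ, ‖zbhat ζ‖ ≤ b)
    (hlam : 0 ≤ lam) (x : EuclideanSpace ℂ (Fin n)) {ζ : ℂ} (hζ : ζ ∈ bernsteinEllipse ρ) :
    ‖fHat zAhat zbhat lam x ζ‖ ≤
      (n * a ^ 2 + b ^ 2) * (‖x‖ ^ 2 + 1) + lam / 2 * ‖x‖ ^ 2 := by
  have key : ∀ ξ ∈ bernsteinEllipse ρ, ‖(∑ i, star (zAhat ξ i) * x i) - star (zbhat ξ)‖ ^ 2 ≤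
      (n * a ^ 2 + b ^ 2) * (‖x‖ ^ 2 + 1) := fun ξ hξ =>
    norm_sum_mul_sub_sq_le (fun i => by
      rw [norm_star]; exact (norm_le_pi_norm _ i).trans (hA ξ hξ))
      (by rw [norm_star]; exact hb ξ hξ) x
  have h1 := key _ (star_mem_bernsteinEllipse hζ)
  have h2 := key ζ hζ
  rw [← norm_star, star_sub, star_sum, star_star] at h2
  simp only [star_mul', star_star] at h2
  refine (norm_add_le _ _).trans (add_le_add ?_ ?_)
  · rw [norm_mul]
    refine le_trans ?_ (max_le h1 h2)
    rcases le_total ‖(∑ i, star (zAhat (star ζ) i) * x i) - star (zbhat (star ζ))‖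
      ‖(∑ i, zAhat ζ i * star (x i)) - zbhat ζ‖ with h | h
    · refine le_trans ?_ (le_max_right _ _)
      rw [sq]
      exact mul_le_mul_of_nonneg_right h (norm_nonneg _)
    · refine le_trans ?_ (le_max_left _ _)
      rw [sq]
      exact mul_le_mul_of_nonneg_left h (norm_nonneg _)
  · rw [Complex.norm_real, Real.norm_of_nonneg (by positivity)]

theorem L2_norm_sq_eq_integral {Ω : Type*} [MeasurableSpace Ω] {μ : Measure Ω} (f : Lp ℂ 2 μ) :
    ‖f‖ ^ 2 = ∫ t, ‖f t‖ ^ 2 ∂μ := by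
  have h := inner_self_eq_norm_sq_to_K (𝕜 := ℂ) f
  rw [MeasureTheory.L2.inner_def] at h
  simp only [inner_self_eq_norm_sq_to_K] at h
  have h' : ((∫ t, ‖f t‖ ^ 2 ∂μ : ℝ) : ℂ) = ((‖f‖ ^ 2 : ℝ) : ℂ) := by
    rw [← integral_complex_ofReal]
    push_cast
    exact h
  exact (Complex.ofReal_injective h').symm

theorem integral_lebesgueIcc (f : ℝ → ℝ) :
    ∫ t, f t ∂lebesgueIcc = ∫ t in (-1 : ℝ)..1, f t := by
  rw [intervalIntegral.integral_of_le (by norm_num), lebesgueIcc, integral_Icc_eq_integral_Ioc]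

theorem objective_eq_integral_fInt {A : TallQuasimatrix n (Lp ℂ 2 lebesgueIcc)}
    {b : Lp ℂ 2 lebesgueIcc} {zA : ℝ → EuclideanSpace ℂ (Fin n)} {zb : ℝ → ℂ}
    (hA : IsCoordRep lebesgueIcc A zA)
    (hb : IsCoordRep lebesgueIcc (fun _ : Fin 1 => b) (fun t => !₂[zb t])) {lam : ℝ}
    {x : EuclideanSpace ℂ (Fin n)}
    (hf : IntervalIntegrable (fInt zA zb lam x) volume (-1) 1) :
    objective A b lam x = ∫ t in (-1 : ℝ)..1, fInt zA zb lam x t := by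
  have hb' : (b : ℝ → ℂ) =ᵐ[lebesgueIcc] fun t => star (zb t) := by
    have h := hb.mulVec_eq !₂[1]
    simpa [TallQuasimatrix.mulVec] using h
  have hnorm : ‖A.mulVec x - b‖ ^ 2 =
      ∫ t in (-1 : ℝ)..1, ‖(∑ i, star (zA t i) * x i) - star (zb t)‖ ^ 2 := by
    rw [L2_norm_sq_eq_integral, ← integral_lebesgueIcc]
    refine integral_congr_ae ?_
    filter_upwards [Lp.coeFn_sub (A.mulVec x) b, hA.mulVec_eq x, hb'] with t h1 h2 h3
    rw [h1, Pi.sub_apply, h2, h3]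
    simp only [mul_comm]
  have hsq : IntervalIntegrable
      (fun t => ‖(∑ i, star (zA t i) * x i) - star (zb t)‖ ^ 2) volume (-1) 1 := by
    have h : (fun t => ‖(∑ i, star (zA t i) * x i) - star (zb t)‖ ^ 2) =
        fun t => fInt zA zb lam x t - lam / 2 * ‖x‖ ^ 2 := funext fun t => by rw [fInt]; ring
    rw [h]
    exact hf.sub intervalIntegrable_const
  simp only [fInt]
  rw [objective, hnorm, intervalIntegral.integral_add hsq intervalIntegrable_const,
    intervalIntegral.integral_const, smul_eq_mul]
  ring

theorem IsGaussLegendre.finiteObjective_eq_sum_fInt {s : ℕ} {η w : Fin s → ℝ}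
    (h : IsGaussLegendre s η w) (hs : 0 < s) (zA : ℝ → EuclideanSpace ℂ (Fin n)) (zb : ℝ → ℂ)
    (lam : ℝ) (x : EuclideanSpace ℂ (Fin n)) :
    finiteObjective (sampledMatrix zA η w) (sampledVector zb η w) lam x =
      ∑ j, w j ^ 2 * fInt zA zb lam x (η j) := by
  simp only [fInt, mul_add, Finset.sum_add_distrib, ← Finset.sum_mul, h.sum_sq hs]
  rw [finiteObjective, EuclideanSpace.norm_sq_eq]
  congr 1
  · refine Finset.sum_congr rfl fun j _ => ?_
    have : (sampledMatrix zA η w).mulVec x.ofLp j - sampledVector zb η w j =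
        w j * ((∑ i, star (zA (η j) i) * x i) - star (zb (η j))) := by
      simp [sampledMatrix, sampledVector, Matrix.mulVec, dotProduct, mul_sub, Finset.mul_sum,
        mul_assoc]
    rw [PiLp.toLp_apply, Pi.sub_apply, this, norm_mul, mul_pow, Complex.norm_real, Real.norm_eq_abs, sq_abs]
  · ring

theorem log_bound_pos {K ε : ℝ} (hK : 0 ≤ K) (hε0 : 0 < ε) (hε1 : ε < 1) {s : ℕ}
    (hs : (Real.log (8 * (K + 1)) - Real.log ε - Real.log √2) / (2 * Real.log (1 + √2)) + 1 ≤
      (s : ℝ)) : 0 < s := by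
  have h2 : √2 ≤ 8 * (K + 1) := by
    have : √2 ≤ 2 := Real.sqrt_le_iff.mpr (by norm_num)
    linarith
  have h3 := Real.log_le_log (by positivity) h2
  have h4 := Real.log_neg hε0 hε1
  have h5 : 0 < Real.log (1 + √2) := Real.log_pos (by simp)
  have h6 : 0 ≤ (Real.log (8 * (K + 1)) - Real.log ε - Real.log √2) /
      (2 * Real.log (1 + √2)) := div_nonneg (by linarith) (by positivity)
  have : (0 : ℝ) < s := by linarith
  exact_mod_cast this

theorem quadrature_bound_le {K ε : ℝ} (hK : 0 ≤ K) (hε0 : 0 < ε) {s : ℕ}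
    (hs : (Real.log (8 * (K + 1)) - Real.log ε - Real.log √2) / (2 * Real.log (1 + √2)) + 1 ≤
      (s : ℝ)) :
    8 * (K + 1) * (1 + √2)⁻¹ ^ (2 * s) / (1 - (1 + √2)⁻¹) ≤ ε := by
  have hsq : √2 ^ 2 = (2 : ℝ) := Real.sq_sqrt (by norm_num)
  have hlt : 1 < √2 := Real.lt_sqrt_of_sq_lt (by norm_num)
  have hlt' : √2 < 3 / 2 := by rw [Real.sqrt_lt' (by norm_num)]; norm_num
  have hinv : (1 + √2)⁻¹ = √2 - 1 := by
    rw [inv_eq_iff_eq_inv, eq_comm, inv_eq_of_mul_eq_one_left]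
    linarith
  have hlog : 0 < Real.log (1 + √2) := Real.log_pos (by simp)
  have h1 : 8 * (K + 1) ≤ ε * √2 * (1 + √2) ^ (2 * s) * (1 + √2)⁻¹ ^ 2 := by
    have hR : Real.log (ε * √2 * (1 + √2) ^ (2 * s) * (1 + √2)⁻¹ ^ 2) =
        Real.log ε + Real.log √2 + (2 * s : ℕ) * Real.log (1 + √2) - 2 * Real.log (1 + √2) := by
      rw [Real.log_mul (by positivity) (by positivity),
        Real.log_mul (by positivity) (by positivity),
        Real.log_mul (by positivity) (by positivity), Real.log_pow, Real.log_pow, Real.log_inv]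
      push_cast
      ring
    rw [← Real.log_le_log_iff (by positivity) (by positivity), hR]
    rw [← le_sub_iff_add_le, div_le_iff₀ (by positivity)] at hs
    push_cast
    linarith
  have h2 : 8 * (K + 1) * (1 + √2)⁻¹ ^ (2 * s) ≤ ε * √2 * (1 + √2)⁻¹ ^ 2 := by
    rw [inv_pow _ (2 * s), ← div_eq_mul_inv, div_le_iff₀ (by positivity)]
    linarith
  rw [div_le_iff₀ (by rw [hinv]; linarith)]
  refine h2.trans ?_
  rw [mul_assoc]
  refine mul_le_mul_of_nonneg_left ?_ hε0.le
  rw [hinv]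
  nlinarith

end SILR

theorem mainTheorem4 {n : ℕ}
    (A : SILR.TallQuasimatrix n (Lp ℂ 2 SILR.lebesgueIcc)) (b : Lp ℂ 2 SILR.lebesgueIcc)
    (zA : ℝ → EuclideanSpace ℂ (Fin n)) (zb : ℝ → ℂ)
    (hA : SILR.IsCoordRep SILR.lebesgueIcc A zA)
    (hb : SILR.IsCoordRep SILR.lebesgueIcc (fun _ : Fin 1 => b) (fun t => !₂[zb t]))
    (lam : ℝ) (hlam : 0 < lam)
    -- the analytic continuations to the inside of the ellipse
    (zAhat : ℂ → Fin n → ℂ) (zbhat : ℂ → ℂ)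
    (hzA : DifferentiableOn ℂ zAhat (SILR.ellipseInterior Complex.I))
    (hzb : DifferentiableOn ℂ zbhat (SILR.ellipseInterior Complex.I))
    (hzA_eq : ∀ t ∈ Icc (-1 : ℝ) 1, ∀ i, zAhat (t : ℂ) i = zA t i)
    (hzb_eq : ∀ t ∈ Icc (-1 : ℝ) 1, zbhat (t : ℂ) = zb t)
    -- `‖zAhat ζ‖` is the maximum norm on `Fin n → ℂ`
    (MA Mb : ℝ)
    (hMA : IsLUB ((fun ζ => ‖zAhat ζ‖) '' SILR.ellipseInterior Complex.I) MA)
    (hMb : IsLUB ((fun ζ => ‖zbhat ζ‖) '' SILR.ellipseInterior Complex.I) Mb)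
    (ε : ℝ) (hε0 : 0 < ε) (hε1 : ε < 1)
    (s : ℕ)
    (hs : (Real.log (8 * (lam⁻¹ * (n * MA ^ 2 + Mb ^ 2) + 1)) - Real.log ε - Real.log √2)
        / (2 * Real.log (1 + √2)) + 1 ≤ (s : ℝ)) :
    (∃ η w : Fin s → ℝ, SILR.IsGaussLegendre s η w) ∧
    ∀ η w : Fin s → ℝ, SILR.IsGaussLegendre s η w →
      ∀ x : EuclideanSpace ℂ (Fin n),
        |(∫ t in (-1 : ℝ)..1, SILR.gInt zA zb lam x t)
            - ∑ j, w j ^ 2 * SILR.gInt zA zb lam x (η j)| ≤ ε ∧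
        (1 - ε) * (SILR.objective A b lam x + lam) ≤
          SILR.finiteObjective (SILR.sampledMatrix zA η w) (SILR.sampledVector zb η w) lam x
            + lam ∧
        SILR.finiteObjective (SILR.sampledMatrix zA η w) (SILR.sampledVector zb η w) lam x + lam ≤
          (1 + ε) * (SILR.objective A b lam x + lam) := by
  have hρ : 1 < 1 + √2 := by simp
  rw [SILR.ellipseInterior_I] at hzA hzb hMA hMb
  have hA' : ∀ ζ ∈ SILR.bernsteinEllipse (1 + √2), ‖zAhat ζ‖ ≤ MA := fun ζ hζ =>
    hMA.1 (mem_image_of_mem _ hζ)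
  have hb' : ∀ ζ ∈ SILR.bernsteinEllipse (1 + √2), ‖zbhat ζ‖ ≤ Mb := fun ζ hζ =>
    hMb.1 (mem_image_of_mem _ hζ)
  have hK : 0 ≤ lam⁻¹ * (n * MA ^ 2 + Mb ^ 2) := by positivity
  have hs0 := SILR.log_bound_pos hK hε0 hε1 hs
  refine ⟨SILR.exists_isGaussLegendre s, fun η w h x => ?_⟩
  have hdiff := SILR.differentiableOn_fHat hzA hzb lam x
  have hfHat : ∀ t ∈ Icc (-1 : ℝ) 1, SILR.fHat zAhat zbhat lam x t = SILR.fInt zA zb lam x t :=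
    fun t ht => SILR.fHat_ofReal (hzA_eq t ht) (hzb_eq t ht) lam x
  have hcont : ContinuousOn (SILR.fInt zA zb lam x) (uIcc (-1) 1) := by
    rw [uIcc_of_le (by norm_num)]
    have h1 : ContinuousOn (fun t : ℝ => (SILR.fHat zAhat zbhat lam x t).re) (Icc (-1) 1) :=
      Complex.continuous_re.comp_continuousOn (hdiff.continuousOn.comp
        Complex.continuous_ofReal.continuousOn
        fun t ht => SILR.ofReal_mem_bernsteinEllipse hρ ht)
    exact h1.congr fun t ht => by simp [hfHat t ht]
  have hint := hcont.intervalIntegrable (μ := volume)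
  set D := (∫ t in (-1 : ℝ)..1, SILR.fInt zA zb lam x t) + lam with hD
  have hDge : lam * (‖x‖ ^ 2 + 1) ≤ D := by
    have h1 := intervalIntegral.integral_mono_on (a := -1) (b := 1) (by norm_num)
      (intervalIntegrable_const (c := lam / 2 * ‖x‖ ^ 2) (μ := volume)) hint
      fun t _ => le_add_of_nonneg_left (sq_nonneg _)
    rw [intervalIntegral.integral_const, smul_eq_mul] at h1
    linarith
  have hDpos : 0 < D := lt_of_lt_of_le (by positivity) hDge
  have hbound : ∀ ζ ∈ SILR.bernsteinEllipse (1 + √2),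
      ‖SILR.fHat zAhat zbhat lam x ζ / D‖ ≤ lam⁻¹ * (n * MA ^ 2 + Mb ^ 2) + 1 := by
    intro ζ hζ
    rw [norm_div, Complex.norm_real, Real.norm_of_nonneg hDpos.le, div_le_iff₀ hDpos]
    refine (SILR.norm_fHat_le hA' hb' hlam.le x hζ).trans
      (le_trans ?_ (mul_le_mul_of_nonneg_left hDge (by positivity)))
    have h1 : (lam⁻¹ * (n * MA ^ 2 + Mb ^ 2) + 1) * (lam * (‖x‖ ^ 2 + 1)) =
        (n * MA ^ 2 + Mb ^ 2) * (‖x‖ ^ 2 + 1) + lam * (‖x‖ ^ 2 + 1) := by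
      field_simp
    have : 0 ≤ lam * ‖x‖ ^ 2 := by positivity
    rw [h1]
    linarith
  have herr : |(∫ t in (-1 : ℝ)..1, SILR.gInt zA zb lam x t)
      - ∑ j, w j ^ 2 * SILR.gInt zA zb lam x (η j)| ≤ ε := by
    refine (h.abs_integral_sub_sum_le_of_bernsteinEllipse hs0 hρ (hdiff.div_const (D : ℂ))
      hbound fun t ht => ?_).trans (SILR.quadrature_bound_le hK hε0 hs)
    rw [hfHat t ht, SILR.gInt, Complex.ofReal_div]
  refine ⟨herr, ?_⟩
  have hobj := SILR.objective_eq_integral_fInt hA hb hint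
  have hfin := h.finiteObjective_eq_sum_fInt hs0 zA zb lam x
  have hg : (∫ t in (-1 : ℝ)..1, SILR.gInt zA zb lam x t)
      - ∑ j, w j ^ 2 * SILR.gInt zA zb lam x (η j) =
      (SILR.objective A b lam x - SILR.finiteObjective (SILR.sampledMatrix zA η w)
        (SILR.sampledVector zb η w) lam x) / D := by
    simp only [SILR.gInt, ← hD]
    rw [intervalIntegral.integral_div, hobj, hfin, sub_div, Finset.sum_div]
    simp only [mul_div_assoc]
  rw [hg, abs_div, abs_of_pos hDpos, div_le_iff₀ hDpos, abs_le] at herr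
  have hDobj : D = SILR.objective A b lam x + lam := by rw [hD, hobj]
  rw [← hDobj]
  constructor <;> linarith [herr.1, herr.2]
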